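/- Two polynomials with integer coefficients are said to dyadically resolve if their resultant equals $2^k$ or $-2^k$ for some integer $k \ge 0$. For a positive integer $n$, let $T(n)$ be the graph on the vertex set $\{1, 2, \dots, n-1\}$ in which two distinct vertices $i$ and $j$ are adjacent if and only if $x^n - x^i + 1$ and $x^n - x^j + 1$ dyadically resolve. Let $\nu_2(n)$ be the largest $v$ such that $2^v$ divides $n$. Theorem. For every integer $n \ge 1$, the largest clique in $T(n)$ has at most $2 \lfloor \log_2 n \rfloor - \nu_2(n)$ vertices. Moreover, $T(n)$ has a proper coloring with $2 \lfloor \log_2 n \rfloor - \nu_2(n)$ colors in which each color class (possibly empty) is the set of all vertices $k$ with $k \equiv r \pmod{2^t}$, for some integers $r, t \ge 0$ depending on the color. -/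

import Mathlib

open Polynomial

/-- Two integer polynomials dyadically resolve if their resultant is a signed power of `2`,
that is, of the form `± 2 ^ k` with `k` a nonnegative integer. -/
def DyadicallyResolve (f g : ℤ[X]) : Prop :=
  ∃ k : ℕ, resultant f g = 2 ^ k ∨ resultant f g = -2 ^ k

/-- The trinomial `x ^ n - x ^ k + 1`. -/
noncomputable def tri (n k : ℕ) : ℤ[X] := X ^ n - X ^ k + 1

theorem DyadicallyResolve.symm {f g : ℤ[X]} (h : DyadicallyResolve f g) :
    DyadicallyResolve g f := by
  obtain ⟨k, hk⟩ := h
  refine ⟨k, ?_⟩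
  rw [resultant_comm]
  rcases neg_one_pow_eq_or ℤ (g.natDegree * f.natDegree) with e | e <;>
    rcases hk with hk | hk <;> simp [e, hk]

/-- The graph `T(n)` on the vertices `1, 2, …, n - 1`, in which distinct vertices `i` and `j` are
adjacent if and only if `x ^ n - x ^ i + 1` and `x ^ n - x ^ j + 1` dyadically resolve. -/
def trinomialGraph (n : ℕ) : SimpleGraph (Set.Ico 1 n) where
  Adj i j := i ≠ j ∧ DyadicallyResolve (tri n i) (tri n j)
  symm := ⟨fun _ _ h => ⟨h.1.symm, h.2.symm⟩⟩
  loopless := ⟨fun _ h => h.1 rfl⟩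

/-! The resultant lies in the ideal generated by the two trinomials, so a common root in odd
characteristic rules out `± 2 ^ k`. Write `v` for the valuation of `n`. If `ω ^ 2 ^ w = -1`, then `ω
^ k` depends only on `k` modulo `2 ^ (w + 1)`, so one `ω` serves a whole residue class. Three kinds
of class cover all vertices: - valuation `w < v`: `ω ^ n = 1`, `ω ^ k = -1`, and the trinomial is
`3`, zero in characteristic 3; - valuation `w > v`: `ω ^ k = -1`, and `ω ^ n = -2` is needed; -
valuation `v`, with `n - k` of valuation `w > v`: `ω ^ k = -ω ^ n`, and `ω ^ n = -1/2` is needed.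
The last two are solvable modulo a prime factor of the Fermat number `2 ^ 2 ^ (w - v) + 1`. With `L
= Nat.log 2 n`, the classes number `v + (L - v) + (L - v)`. -/

theorem natDegree_tri {n k : ℕ} (hk : k < n) : (tri n k).natDegree = n := by
  have h1 : (1 - X ^ k : ℤ[X]).natDegree ≤ k := by compute_degree
  rw [tri, sub_add_eq_add_sub, add_sub_assoc, natDegree_add_eq_left_of_natDegree_lt, natDegree_X_pow]
  rw [natDegree_X_pow]
  exact h1.trans_lt hk

/-- A common root in characteristic other than `2` forbids dyadic resolution. -/
theorem not_dyadicallyResolve_of_common_root {K : Type*} [Field K] (h2 : (2 : K) ≠ 0)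
    {f g : ℤ[X]} (hf : f.natDegree ≠ 0) {ω : K} (hfω : aeval ω f = 0) (hgω : aeval ω g = 0) :
    ¬ DyadicallyResolve f g := by
  rintro ⟨k, hk⟩
  obtain ⟨p, q, -, -, e⟩ := exists_mul_add_mul_eq_C_resultant f g le_rfl le_rfl (Or.inl hf)
  have h := congrArg (aeval ω) e
  rw [map_add, map_mul, map_mul, hfω, hgω, zero_mul, zero_mul, add_zero, aeval_C] at h
  rcases hk with hk | hk <;> rw [hk] at h <;>
    exact pow_ne_zero k h2 (by simpa using h.symm)

/-- Two trinomials share the root `ω` when their inner exponents act alike on `ω`. -/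
theorem not_dyadicallyResolve_tri {K : Type*} [Field K] (h2 : (2 : K) ≠ 0) {n i j r s : ℕ}
    (hi : i < n) {ω : K} (hω : ω ^ s = 1) (hir : i ≡ r [MOD s]) (hjr : j ≡ r [MOD s])
    (h : ω ^ n - ω ^ r + 1 = 0) : ¬ DyadicallyResolve (tri n i) (tri n j) := by
  refine not_dyadicallyResolve_of_common_root h2 (ω := ω)
    (by rw [natDegree_tri hi]; omega) ?_ ?_ <;>
  simp [tri, pow_eq_pow_of_modEq hir hω, pow_eq_pow_of_modEq hjr hω, h]

theorem pow_two_pow_succ_eq_one {R : Type*} [Ring R] {ω : R} {w : ℕ}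
    (h : ω ^ 2 ^ w = -1) : ω ^ 2 ^ (w + 1) = 1 := by
  rw [pow_succ, pow_mul, h]; simp

/-- An element of order `2 ^ (e + 1)` is the `n`-th power of one of order `2 ^ (v + e + 1)`,
where `2 ^ v` is the exact power of `2` dividing `n`. -/
theorem exists_pow_eq_and_pow_two_pow_eq_neg_one {K : Type*} [Field K] [IsAlgClosed K] {a : K}
    {e v m : ℕ} (ha : a ^ 2 ^ e = -1) (hm : Odd m) :
    ∃ ω : K, ω ^ (2 ^ v * m) = a ∧ ω ^ 2 ^ (v + e) = -1 := by
  have hcop : Nat.Coprime m (2 ^ (e + 1)) := (Nat.coprime_two_right.2 hm).pow_right _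
  -- With `l` inverse to `m` modulo the order of `a`, any `2 ^ v`-th root of `a ^ l` works; oddness
  -- of `l` preserves the value `-1`.
  obtain ⟨l, hl⟩ := Nat.exists_mul_mod_eq_one_of_coprime hcop (Nat.one_lt_two_pow (by omega))
  have hl1 : m * l ≡ 1 [MOD 2 ^ (e + 1)] := by
    rw [Nat.ModEq, hl.2, Nat.mod_eq_of_lt (Nat.one_lt_two_pow (by omega))]
  have hlodd : Odd l := by
    have h2 : m * l ≡ 1 [MOD 2] := hl1.of_dvd (dvd_pow_self 2 (by omega))
    exact (Nat.odd_mul.1 (Nat.odd_iff.2 h2)).2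
  obtain ⟨ω, hω⟩ := IsAlgClosed.exists_pow_nat_eq (a ^ l) (n := 2 ^ v) (by positivity)
  refine ⟨ω, ?_, ?_⟩
  · rw [pow_mul, hω, ← pow_mul, mul_comm l m,
      pow_eq_pow_of_modEq hl1 (pow_two_pow_succ_eq_one ha), pow_one]
  · rw [pow_add, pow_mul, hω, ← pow_mul, mul_comm, pow_mul, ha, hlodd.neg_one_pow]

theorem two_ne_zero_of_charP_ne_two {K : Type*} [Field K] (p : ℕ) [CharP K p] (hp : p ≠ 2) :
    (2 : K) ≠ 0 :=
  Ring.two_ne_zero (by rwa [ringChar.eq K p])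

/-- For `e > 0` there is an algebraically closed field of odd characteristic in which `2` has
order `2 ^ (e + 1)`. -/
theorem exists_isAlgClosed_two_pow_eq_neg_one (e : ℕ) :
    ∃ (K : Type) (_ : Field K), IsAlgClosed K ∧ (2 : K) ≠ 0 ∧ (2 : K) ^ 2 ^ e = -1 := by
  have hne : 2 ^ 2 ^ e + 1 ≠ 1 := by simp
  have hp : Fact (2 ^ 2 ^ e + 1).minFac.Prime := ⟨Nat.minFac_prime hne⟩
  refine ⟨AlgebraicClosure (ZMod (2 ^ 2 ^ e + 1).minFac), inferInstance, inferInstance, ?_, ?_⟩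
  · refine two_ne_zero_of_charP_ne_two (2 ^ 2 ^ e + 1).minFac fun h => ?_
    have h1 : (2 ^ 2 ^ e + 1).minFac ∣ 2 ^ 2 ^ e + 1 := Nat.minFac_dvd _
    rw [h] at h1
    have h3 : 2 ∣ 2 ^ 2 ^ e := dvd_pow_self 2 (by positivity)
    omega
  · have h := (CharP.cast_eq_zero_iff (AlgebraicClosure (ZMod (2 ^ 2 ^ e + 1).minFac))
      (2 ^ 2 ^ e + 1).minFac (2 ^ 2 ^ e + 1)).2 (Nat.minFac_dvd _)
    push_cast at h
    exact eq_neg_of_add_eq_zero_left h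

/-- Vertices of `2`-adic valuation `w` less than that of `n` do not dyadically resolve. -/
theorem not_dyadicallyResolve_tri_of_dvd {n i j w : ℕ} (hn : 2 ^ (w + 1) ∣ n) (hi : i < n)
    (hiw : i ≡ 2 ^ w [MOD 2 ^ (w + 1)]) (hjw : j ≡ 2 ^ w [MOD 2 ^ (w + 1)]) :
    ¬ DyadicallyResolve (tri n i) (tri n j) := by
  have : Fact (Nat.Prime 3) := ⟨Nat.prime_three⟩
  let K := AlgebraicClosure (ZMod 3)
  obtain ⟨ω, hω⟩ := IsAlgClosed.exists_pow_nat_eq (-1 : K) (n := 2 ^ w) (by positivity)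
  have h1 := pow_two_pow_succ_eq_one hω
  have h3 : ((3 : ℕ) : K) = 0 := CharP.cast_eq_zero K 3
  refine not_dyadicallyResolve_tri (two_ne_zero_of_charP_ne_two 3 (by norm_num)) hi h1 hiw hjw ?_
  obtain ⟨c, rfl⟩ := hn
  rw [pow_mul, h1, hω]
  push_cast at h3
  linear_combination h3

/-- Vertices of `2`-adic valuation `v + e` greater than that of `n` do not dyadically resolve. -/
theorem not_dyadicallyResolve_tri_of_lt_valuation {v m e i j : ℕ} (hm : Odd m)
    (hi : i < 2 ^ v * m) (hiw : i ≡ 2 ^ (v + e) [MOD 2 ^ (v + e + 1)])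
    (hjw : j ≡ 2 ^ (v + e) [MOD 2 ^ (v + e + 1)]) (he : e ≠ 0) :
    ¬ DyadicallyResolve (tri (2 ^ v * m) i) (tri (2 ^ v * m) j) := by
  obtain ⟨K, _, _, h2, hK⟩ := exists_isAlgClosed_two_pow_eq_neg_one e
  -- Here `e ≠ 0` matters: the exponent is even, so the sign disappears.
  have ha : (-2 : K) ^ 2 ^ e = -1 := by
    rw [Even.neg_pow (Nat.even_pow.2 ⟨even_two, he⟩), hK]
  obtain ⟨ω, hω, hω'⟩ := exists_pow_eq_and_pow_two_pow_eq_neg_one (v := v) ha hm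
  refine not_dyadicallyResolve_tri h2 hi (pow_two_pow_succ_eq_one hω') hiw hjw ?_
  rw [hω, hω']
  ring

/-- Vertices at distance from `n` of `2`-adic valuation `v + e`, greater than that of `n`, do not
dyadically resolve. -/
theorem not_dyadicallyResolve_tri_of_modEq_add {v m e i j : ℕ} (hm : Odd m)
    (hi : i < 2 ^ v * m) (hiw : i ≡ 2 ^ v * m + 2 ^ (v + e) [MOD 2 ^ (v + e + 1)])
    (hjw : j ≡ 2 ^ v * m + 2 ^ (v + e) [MOD 2 ^ (v + e + 1)]) (he : e ≠ 0) :
    ¬ DyadicallyResolve (tri (2 ^ v * m) i) (tri (2 ^ v * m) j) := by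
  obtain ⟨K, _, _, h2, hK⟩ := exists_isAlgClosed_two_pow_eq_neg_one e
  have ha : (-2⁻¹ : K) ^ 2 ^ e = -1 := by
    rw [Even.neg_pow (Nat.even_pow.2 ⟨even_two, he⟩), inv_pow, hK, inv_neg, inv_one]
  obtain ⟨ω, hω, hω'⟩ := exists_pow_eq_and_pow_two_pow_eq_neg_one (v := v) ha hm
  refine not_dyadicallyResolve_tri h2 hi (pow_two_pow_succ_eq_one hω') hiw hjw ?_
  rw [pow_add _ (2 ^ v * m), hω, hω']
  field_simp
  ring

theorem padicValNat_two_pow_mul_odd {v m : ℕ} (hm : Odd m) : padicValNat 2 (2 ^ v * m) = v := by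
  rw [padicValNat.mul (by positivity) hm.pos.ne', padicValNat.prime_pow,
    padicValNat.eq_zero_of_not_dvd (by simpa [← even_iff_two_dvd] using hm), add_zero]

theorem padicValNat_two_eq_iff_modEq {k u : ℕ} (hk : k ≠ 0) :
    padicValNat 2 k = u ↔ k ≡ 2 ^ u [MOD 2 ^ (u + 1)] := by
  constructor
  · rintro rfl
    obtain ⟨v, m, hm, h⟩ := Nat.exists_eq_two_pow_mul_odd hk
    have hv : padicValNat 2 k = v := by rw [h, padicValNat_two_pow_mul_odd hm]
    obtain ⟨c, rfl⟩ := hm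
    rw [hv, h, show 2 ^ v * (2 * c + 1) = 2 ^ v + 2 ^ (v + 1) * c by ring]
    simp [Nat.ModEq]
  · intro h
    have h1 : 2 ^ u ∣ k :=
      ((h.of_dvd (pow_dvd_pow 2 (Nat.le_succ u))).dvd_iff dvd_rfl).2 dvd_rfl
    have h2 : ¬ 2 ^ (u + 1) ∣ k := fun hd =>
      absurd (Nat.pow_dvd_pow_iff_le_right'.1 ((h.dvd_iff dvd_rfl).1 hd)) (by omega)
    rw [padicValNat_dvd_iff_le hk] at h1 h2
    omega

/-- Since `w` exceeds the valuation of `n`, the condition on `n - k` already forces `k` to have that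
valuation, so one congruence captures both. The sign of `2 ^ w` is immaterial modulo `2 ^ (w + 1)`.
-/
theorem padicValNat_two_eq_and_sub_eq_iff_modEq {n k w : ℕ} (hk : k ≠ 0) (hkn : k < n)
    (hw : padicValNat 2 n < w) :
    padicValNat 2 k = padicValNat 2 n ∧ padicValNat 2 (n - k) = w ↔
      k ≡ n + 2 ^ w [MOD 2 ^ (w + 1)] := by
  obtain ⟨d, rfl⟩ := Nat.exists_eq_add_of_lt hkn
  have hd : k + d + 1 - k = d + 1 := by omega
  rw [hd, add_assoc] at *
  have key : k ≡ k + (d + 1) + 2 ^ w [MOD 2 ^ (w + 1)] ↔ d + 1 ≡ 2 ^ w [MOD 2 ^ (w + 1)] := by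
    have h0 : 0 ≡ 2 ^ w + 2 ^ w [MOD 2 ^ (w + 1)] := by
      simp [Nat.ModEq, ← two_mul, ← pow_succ']
    rw [add_assoc]
    refine ⟨fun h => ?_, fun h => ?_⟩
    · exact ((Nat.ModEq.add_left_cancel' (a := 0) k h).symm.trans h0).add_right_cancel' _
    · exact (h0.trans (h.symm.add_right _)).add_left k
  rw [key, padicValNat_two_eq_iff_modEq (k := d + 1) (by omega), and_iff_right_iff_imp]
  intro h
  have hn := (padicValNat_two_eq_iff_modEq (k := k + (d + 1)) (by omega)).1 rfl
  have hd0 : d + 1 ≡ 0 [MOD 2 ^ (padicValNat 2 (k + (d + 1)) + 1)] :=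
    (h.of_dvd (pow_dvd_pow 2 (by omega))).trans (Nat.modEq_zero_iff_dvd.2 (pow_dvd_pow 2 hw))
  exact (padicValNat_two_eq_iff_modEq hk).2 (((hd0.symm.add_left k)).trans hn)

/-- The color of `k` in `T(n)`: first the valuations of `k` below that of `n`, then those above,
then the valuations of `n - k` for `k` of the same valuation as `n`. -/
def trinomialColor (n k : ℕ) : ℕ :=
  if padicValNat 2 k < padicValNat 2 n then padicValNat 2 k
  else if padicValNat 2 n < padicValNat 2 k then padicValNat 2 k - 1
  else Nat.log 2 n + padicValNat 2 (n - k) - padicValNat 2 n - 1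

/-- The difference of two odd multiples of `2 ^ v` is divisible by `2 ^ (v + 1)`. -/
theorem padicValNat_two_lt_sub_of_eq {n k : ℕ} (hk : k ≠ 0) (hkn : k < n)
    (h : padicValNat 2 k = padicValNat 2 n) : padicValNat 2 n < padicValNat 2 (n - k) := by
  have h1 := (padicValNat_two_eq_iff_modEq hk).1 h
  have h2 := (padicValNat_two_eq_iff_modEq (k := n) (by omega)).1 rfl
  exact (padicValNat_dvd_iff_le (by omega)).1 ((Nat.modEq_iff_dvd' hkn.le).1 (h1.trans h2.symm))

theorem padicValNat_two_le_log {n k : ℕ} (hkn : k ≤ n) : padicValNat 2 k ≤ Nat.log 2 n :=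
  (padicValNat_le_nat_log k).trans (Nat.log_mono_right hkn)

theorem trinomialColor_lt {n k : ℕ} (hk : k ≠ 0) (hkn : k < n) :
    trinomialColor n k < 2 * Nat.log 2 n - padicValNat 2 n := by
  have h1 := padicValNat_two_le_log hkn.le
  have h2 := padicValNat_two_le_log (Nat.sub_le n k)
  have h3 := padicValNat_two_le_log (le_refl n)
  have h4 := padicValNat_two_lt_sub_of_eq hk hkn
  unfold trinomialColor
  split_ifs <;> omega

/-- Every color class of `trinomialColor` is a residue class modulo a power of `2` whose members
pairwise do not dyadically resolve. -/
theorem exists_modEq_trinomialColor {n : ℕ} (hn : n ≠ 0) (c : ℕ) :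
    ∃ t r : ℕ, (∀ k, k ≠ 0 → k < n → (trinomialColor n k = c ↔ k ≡ r [MOD 2 ^ t])) ∧
      ∀ i j, i < n → i ≡ r [MOD 2 ^ t] → j ≡ r [MOD 2 ^ t] →
        ¬ DyadicallyResolve (tri n i) (tri n j) := by
  obtain ⟨v, m, hm, hnm⟩ := Nat.exists_eq_two_pow_mul_odd hn
  have hv : padicValNat 2 n = v := by
    rw [hnm, padicValNat_two_pow_mul_odd hm]
  have hvL := padicValNat_two_le_log (le_refl n)
  have hbound : ∀ k, k ≠ 0 → k < n → padicValNat 2 k ≤ Nat.log 2 n ∧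
      (padicValNat 2 k = padicValNat 2 n → padicValNat 2 n < padicValNat 2 (n - k)) :=
    fun k hk hkn => ⟨padicValNat_two_le_log hkn.le, padicValNat_two_lt_sub_of_eq hk hkn⟩
  by_cases hcv : c < v
  · refine ⟨c + 1, 2 ^ c, fun k hk hkn => ?_, fun i j hi =>
      not_dyadicallyResolve_tri_of_dvd (hnm ▸ (pow_dvd_pow 2 hcv).mul_right m) hi⟩
    have := hbound k hk hkn
    rw [← padicValNat_two_eq_iff_modEq hk, trinomialColor]
    split_ifs <;> omega
  by_cases hcL : c < Nat.log 2 n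
  · obtain ⟨e, rfl⟩ := Nat.exists_eq_add_of_le (not_lt.1 hcv)
    -- Color `v + e` encodes valuation `v + e + 1`, because valuation `v` itself is skipped.
    refine ⟨v + (e + 1) + 1, 2 ^ (v + (e + 1)), fun k hk hkn => ?_, fun i j hi hiw hjw => ?_⟩
    · have := hbound k hk hkn
      rw [← padicValNat_two_eq_iff_modEq hk, trinomialColor]
      split_ifs <;> omega
    · rw [hnm] at hi ⊢
      exact not_dyadicallyResolve_tri_of_lt_valuation hm hi hiw hjw e.succ_ne_zero
  · obtain ⟨e, rfl⟩ := Nat.exists_eq_add_of_le (not_lt.1 hcL)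
    -- Color `Nat.log 2 n + e` encodes valuation `v + e + 1` of `n - k`; for large `e` the class is
    -- empty among the vertices.
    refine ⟨v + (e + 1) + 1, n + 2 ^ (v + (e + 1)), fun k hk hkn => ?_,
      fun i j hi hiw hjw => ?_⟩
    · have := hbound k hk hkn
      rw [← padicValNat_two_eq_and_sub_eq_iff_modEq hk hkn (by omega), trinomialColor]
      split_ifs <;> omega
    · rw [hnm] at hi hiw hjw ⊢
      exact not_dyadicallyResolve_tri_of_modEq_add hm hi hiw hjw e.succ_ne_zero

theorem mainTheorem3 (n : ℕ) (hn : 0 < n) :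
    ((trinomialGraph n).cliqueNum : ℤ) ≤ 2 * ⌊Real.logb 2 (n : ℝ)⌋ - (padicValNat 2 n : ℤ) ∧
    ∃ m : ℕ, (m : ℤ) = 2 * ⌊Real.logb 2 (n : ℝ)⌋ - (padicValNat 2 n : ℤ) ∧
      ∃ C : (trinomialGraph n).Coloring (Fin m),
        ∀ c : Fin m, ∃ t r : ℕ, ∀ k : Set.Ico 1 n,
          C k = c ↔ (k : ℕ) ≡ r [MOD 2 ^ t] := by
  have hlog : ⌊Real.logb 2 (n : ℝ)⌋ = (Nat.log 2 n : ℤ) := by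
    rw [← Int.log_natCast (R := ℝ), ← Real.floor_logb_natCast (Nat.cast_nonneg n), Nat.cast_two]
  have hm : ((2 * Nat.log 2 n - padicValNat 2 n : ℕ) : ℤ) =
      2 * ⌊Real.logb 2 (n : ℝ)⌋ - (padicValNat 2 n : ℤ) := by
    have := padicValNat_two_le_log (le_refl n)
    rw [hlog]
    omega
  have hpos (k : Set.Ico 1 n) : (k : ℕ) ≠ 0 := Nat.one_le_iff_ne_zero.1 k.2.1
  let C : (trinomialGraph n).Coloring (Fin (2 * Nat.log 2 n - padicValNat 2 n)) :=
    SimpleGraph.Coloring.mk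
      (fun k => ⟨trinomialColor n k, trinomialColor_lt (hpos k) k.2.2⟩) <| by
      intro i j hij heq
      obtain ⟨t, r, hcolor, hres⟩ := exists_modEq_trinomialColor hn.ne' (trinomialColor n j)
      exact hres i j i.2.2 ((hcolor i (hpos i) i.2.2).1 (Fin.mk.inj heq))
        ((hcolor j (hpos j) j.2.2).1 rfl) hij.2
  refine ⟨?_, _, hm, C, fun c => ?_⟩
  · obtain ⟨s, hs⟩ := (trinomialGraph n).exists_isNClique_cliqueNum
    have := hs.isClique.card_le_of_coloring C
    rw [hs.card_eq, Fintype.card_fin] at this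
    rw [← hm]
    exact_mod_cast this
  · obtain ⟨t, r, hcolor, -⟩ := exists_modEq_trinomialColor hn.ne' c
    exact ⟨t, r, fun k => Fin.ext_iff.trans (hcolor k (hpos k) k.2.2)⟩
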